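/- For an associative ring $R$ with unity, call $R$ left McCoy if whenever $f,g\in R[x]\setminus\{0\}$ satisfy $fg=0$, there is a nonzero $s\in R$ with $sg=0$; right McCoy if whenever $f,g\in R[x]\setminus\{0\}$ satisfy $fg=0$, there is a nonzero $s\in R$ with $fs=0$; McCoy if it is both left and right McCoy; and inner McCoy if whenever $f,g\in R[x]\setminus\{0\}$ satisfy $fgf=0$, there is a nonzero $r\in R$ with $frf=0$. Let $L=\mathbb{Z}_2\langle c_0,c_1,d_0,d_1\rangle$ be the free associative unital algebra over $\mathbb{Z}_2=\mathbb{Z}/2\mathbb{Z}$ in four noncommuting indeterminates, let $J$ be the two-sided ideal of $L$ generated by $$c_0d_0,\quad c_0d_1+c_1d_0,\quad c_1d_1,\quad d_id_j\ (0\le i,j\le 1),\quad d_ic_j\ (0\le i,j\le 1),$$ and let $S=L/J$. Then $S$ is inner McCoy and left McCoy. Moreover, writing bars for images in $S$, the polynomials $F(x)=\bar c_0+\bar c_1x$ and $G(x)=\bar d_0+\bar d_1x$ in $S[x]$ are nonzero and satisfy $F(x)G(x)=0$, but $F(x)r\neq 0$ for every nonzero $r\in S$. In particular, $S$ is not right McCoy,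 and hence $S$ is not McCoy. -/

import Mathlib

open Polynomial

/-- `R` is left McCoy: if `f g = 0` with `f, g` nonzero in `R[x]`, then some nonzero `s` in `R`
satisfies `s g = 0`. -/
def IsLeftMcCoy (R : Type*) [Ring R] : Prop :=
  ∀ f g : R[X], f ≠ 0 → g ≠ 0 → f * g = 0 → ∃ s : R, s ≠ 0 ∧ C s * g = 0

/-- `R` is right McCoy: if `f g = 0` with `f, g` nonzero in `R[x]`, then some nonzero `s` in `R`
satisfies `f s = 0`. -/
def IsRightMcCoy (R : Type*) [Ring R] : Prop :=
  ∀ f g : R[X], f ≠ 0 → g ≠ 0 → f * g = 0 → ∃ s : R, s ≠ 0 ∧ f * C s = 0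

/-- `R` is McCoy: both left and right McCoy. -/
def IsMcCoy (R : Type*) [Ring R] : Prop :=
  IsLeftMcCoy R ∧ IsRightMcCoy R

/-- `R` is inner McCoy: if `f g f = 0` with `f, g` nonzero in `R[x]`, then some nonzero `r` in `R`
satisfies `f r f = 0`. -/
def IsInnerMcCoy (R : Type*) [Ring R] : Prop :=
  ∀ f g : R[X], f ≠ 0 → g ≠ 0 → f * g * f = 0 → ∃ r : R, r ≠ 0 ∧ f * C r * f = 0

namespace Nielsen

/-- The four noncommuting indeterminates `c 0, c 1, d 0, d 1`. -/
inductive Gen : Type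
  | c (i : Fin 2)
  | d (i : Fin 2)

/-- The free algebra `ℤ₂⟨c₀, c₁, d₀, d₁⟩`. -/
abbrev L : Type := FreeAlgebra (ZMod 2) Gen

/-- The indeterminate `c i` of `L`. -/
noncomputable def cL (i : Fin 2) : L := FreeAlgebra.ι (ZMod 2) (Gen.c i)

/-- The indeterminate `d i` of `L`. -/
noncomputable def dL (i : Fin 2) : L := FreeAlgebra.ι (ZMod 2) (Gen.d i)

/-- The defining relations. -/
def relators : Set L :=
  {cL 0 * dL 0, cL 0 * dL 1 + cL 1 * dL 0, cL 1 * dL 1} ∪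
    {z | ∃ i j : Fin 2, z = dL i * dL j} ∪ {z | ∃ i j : Fin 2, z = dL i * cL j}

/-- The two-sided ideal of `L` generated by the defining relations. -/
def J : TwoSidedIdeal L := TwoSidedIdeal.span relators

/-- The quotient ring `L / J`. -/
abbrev S : Type := J.ringCon.Quotient

/-- The quotient map `L → S`. -/
def toS : L →+* S := J.ringCon.mk'

/-- The polynomial `c₀ + c₁ x` over `S`. -/
noncomputable def F : S[X] := C (toS (cL 0)) + C (toS (cL 1)) * X

/-- The polynomial `d₀ + d₁ x` over `S`. -/
noncomputable def G : S[X] := C (toS (dL 0)) + C (toS (dL 1)) * X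

end Nielsen

/-! Let `A` be the free algebra on `c₀, c₁`, a domain. Additively `S = A ⊕ M`, where `M`, the kernel
of `toA`, is spanned by `d₀`, `d₁` and the free left `A`-module on `c₁d₀ = c₀d₁`; left
multiplication on normal forms proves this. On the right, `S` acts on `M` through the augmentation.
On the left, it acts on `M / A c₁d₀` through the augmentation and on `A c₁d₀` through `A`.

If `fg = 0`, then `f` or `g` has coefficients in `M`, as `A[x]` is a domain; either way `g` has
augmentation zero, so `d₀g = 0`. If `fgf = 0`, the same witness works unless `f` has nonzero
augmentation, and then `g = 0` by cancelling on both sides. Right McCoy fails because no nonzero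
element is killed on the left by both `c₀` and `c₁`. -/

namespace Polynomial

variable {R A : Type*} [Ring R] [Ring A]

/-- Apply an additive map to every coefficient of a polynomial. -/
noncomputable def coeffMap (φ : R →+ A) (p : R[X]) : A[X] :=
  ∑ i ∈ p.support, monomial i (φ (p.coeff i))

@[simp]
theorem coeff_coeffMap (φ : R →+ A) (p : R[X]) (n : ℕ) :
    (coeffMap φ p).coeff n = φ (p.coeff n) := by
  simp only [coeffMap, finsetSum_coeff, coeff_monomial, Finset.sum_ite_eq', mem_support_iff]
  split_ifs with h
  · rfl
  · simp [notMem_support_iff.mp h]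

theorem coeffMap_eq_zero_iff (φ : R →+ A) (p : R[X]) :
    coeffMap φ p = 0 ↔ ∀ n, φ (p.coeff n) = 0 := by
  simp [Polynomial.ext_iff]

/-- If `φ` turns products of coefficients of `f` and `g` into products, then so does the
coefficientwise extension of `φ` for `f * g`. -/
theorem coeffMap_mul_eq_map_mul (σ : R →+* A) (φ : R →+ A) (f g : R[X])
    (h : ∀ i j, φ (f.coeff i * g.coeff j) = σ (f.coeff i) * φ (g.coeff j)) :
    coeffMap φ (f * g) = f.map σ * coeffMap φ g := by
  ext n
  simp [coeff_mul, h]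

end Polynomial

namespace Nielsen

/-! ### The quotient ring and its maps to and from `A` -/

/-- The free algebra on the images of `c 0` and `c 1`. -/
abbrev A : Type := FreeAlgebra (ZMod 2) (Fin 2)

/-- The augmentation of `A`. -/
noncomputable abbrev aug : A →ₐ[ZMod 2] ZMod 2 := FreeAlgebra.algebraMapInv

theorem aug_ι (i : Fin 2) : aug (FreeAlgebra.ι (ZMod 2) i) = 0 := by
  simp [FreeAlgebra.algebraMapInv]

theorem toS_surjective : Function.Surjective toS := RingCon.mk'_surjective _

theorem toS_eq_zero_of_mem {z : L} (hz : z ∈ relators) : toS z = 0 :=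
  (RingCon.eq _).2 (TwoSidedIdeal.subset_span hz)

/-- The image of `c i` in `S`. -/
noncomputable def cS (i : Fin 2) : S := toS (cL i)

/-- The image of `d i` in `S`. -/
noncomputable def dS (i : Fin 2) : S := toS (dL i)

theorem dS_mul_dS (i j : Fin 2) : dS i * dS j = 0 := by
  rw [dS, dS, ← map_mul]
  exact toS_eq_zero_of_mem (Or.inl (Or.inr ⟨i, j, rfl⟩))

theorem dS_mul_cS (i j : Fin 2) : dS i * cS j = 0 := by
  rw [dS, cS, ← map_mul]
  exact toS_eq_zero_of_mem (Or.inr ⟨i, j, rfl⟩)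

theorem cS_zero_mul_dS_zero : cS 0 * dS 0 = 0 := by
  rw [dS, cS, ← map_mul]
  exact toS_eq_zero_of_mem (Or.inl (Or.inl (Or.inl rfl)))

theorem cS_one_mul_dS_one : cS 1 * dS 1 = 0 := by
  rw [dS, cS, ← map_mul]
  exact toS_eq_zero_of_mem (Or.inl (Or.inl (Or.inr (Or.inr rfl))))

theorem cS_mul_dS_add : cS 0 * dS 1 + cS 1 * dS 0 = 0 := by
  simp only [dS, cS, ← map_mul, ← map_add]
  exact toS_eq_zero_of_mem (Or.inl (Or.inl (Or.inr (Or.inl rfl))))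

theorem add_self_eq_zero {M : Type*} [AddCommGroup M] [Module (ZMod 2) M] (x : M) : x + x = 0 := by
  rw [← two_smul (ZMod 2) x, show (2 : ZMod 2) = 0 from rfl, zero_smul]

theorem cS_zero_mul_dS_one : cS 0 * dS 1 = cS 1 * dS 0 := by
  have h := cS_mul_dS_add
  rw [← add_self_eq_zero (cS 1 * dS 0)] at h
  exact add_right_cancel h

/-- Induction on elements of `S`. -/
theorem S_induction {P : S → Prop} (algebraMap : ∀ r : ZMod 2, P (algebraMap (ZMod 2) S r))
    (c : ∀ i, P (cS i)) (d : ∀ i, P (dS i)) (mul : ∀ s t, P s → P t → P (s * t))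
    (add : ∀ s t, P s → P t → P (s + t)) (s : S) : P s := by
  obtain ⟨z, rfl⟩ := toS_surjective s
  induction z using FreeAlgebra.induction with
  | grade0 r => exact algebraMap r
  | grade1 x =>
    cases x with
    | c i => exact c i
    | d i => exact d i
  | mul a b ha hb => rw [map_mul]; exact mul _ _ ha hb
  | add a b ha hb => rw [map_add]; exact add _ _ ha hb

/-- The universal property of `S`. -/
noncomputable def liftS {B : Type*} [Ring B] [Algebra (ZMod 2) B] (f : Gen → B)
    (h : ∀ z ∈ relators, FreeAlgebra.lift (ZMod 2) f z = 0) : S →ₐ[ZMod 2] B :=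
  J.ringCon.liftₐ (FreeAlgebra.lift (ZMod 2) f) <| by
    have : J ≤ TwoSidedIdeal.ker (FreeAlgebra.lift (ZMod 2) f) :=
      TwoSidedIdeal.span_le.2 fun z hz => (TwoSidedIdeal.mem_ker _).2 (h z hz)
    exact TwoSidedIdeal.ringCon_le_iff.1 this

theorem liftS_cS {B : Type*} [Ring B] [Algebra (ZMod 2) B] (f : Gen → B) (h) (i : Fin 2) :
    liftS f h (cS i) = f (Gen.c i) :=
  FreeAlgebra.lift_ι_apply f _

theorem liftS_dS {B : Type*} [Ring B] [Algebra (ZMod 2) B] (f : Gen → B) (h) (i : Fin 2) :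
    liftS f h (dS i) = f (Gen.d i) :=
  FreeAlgebra.lift_ι_apply f _

/-- A family in `B` satisfying the defining relations kills the relators. -/
theorem lift_relators {B : Type*} [Ring B] [Algebra (ZMod 2) B] (f : Gen → B)
    (h00 : f (.c 0) * f (.d 0) = 0) (h01 : f (.c 0) * f (.d 1) + f (.c 1) * f (.d 0) = 0)
    (h11 : f (.c 1) * f (.d 1) = 0) (hdd : ∀ i j, f (.d i) * f (.d j) = 0)
    (hdc : ∀ i j, f (.d i) * f (.c j) = 0) :
    ∀ z ∈ relators, FreeAlgebra.lift (ZMod 2) f z = 0 := by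
  rintro z (((rfl | rfl | rfl) | ⟨i, j, rfl⟩) | ⟨i, j, rfl⟩) <;>
    simp [cL, dL, h00, h01, h11, hdd, hdc]

/-- The projection of `S` onto `A` that kills `d 0` and `d 1`. -/
noncomputable def toA : S →ₐ[ZMod 2] A :=
  liftS (fun | .c i => FreeAlgebra.ι (ZMod 2) i | .d _ => 0)
    (lift_relators _ (by simp) (by simp) (by simp) (by simp) (by simp))

theorem toA_cS (i : Fin 2) : toA (cS i) = FreeAlgebra.ι (ZMod 2) i := liftS_cS _ _ i

theorem toA_dS (i : Fin 2) : toA (dS i) = 0 := liftS_dS _ _ i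

/-- The augmentation of `S`. -/
noncomputable def augS : S →ₐ[ZMod 2] ZMod 2 := aug.comp toA

theorem augS_apply (s : S) : augS s = aug (toA s) := rfl

/-- The inclusion of `A` into `S`. -/
noncomputable def ofA : A →ₐ[ZMod 2] S := FreeAlgebra.lift (ZMod 2) cS

theorem ofA_ι (i : Fin 2) : ofA (FreeAlgebra.ι (ZMod 2) i) = cS i := FreeAlgebra.lift_ι_apply _ _

/-- All products `d i * c j` and `d i * d j` vanish, so only the constant term of `s` survives. -/
theorem dS_mul (i : Fin 2) (s : S) : dS i * s = augS s • dS i := by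
  induction s using S_induction with
  | algebraMap r => rw [AlgHom.commutes, Algebra.algebraMap_self_apply, ← Algebra.commutes,
      Algebra.smul_def]
  | c j => rw [dS_mul_cS, augS_apply, toA_cS, aug_ι, zero_smul]
  | d j => rw [dS_mul_dS, augS_apply, toA_dS, map_zero, zero_smul]
  | mul s t hs ht => rw [← mul_assoc, hs, smul_mul_assoc, ht, smul_smul, map_mul]
  | add s t hs ht => rw [mul_add, hs, ht, map_add, add_smul]

/-! ### Normal forms -/

/-- The normal forms of elements of `S`: a triple `(a, γ, b)` stands for
`a + γ 0 • d 0 + γ 1 • d 1 + b * (c 1 * d 0)`. -/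
abbrev V : Type := A × (Fin 2 → ZMod 2) × A

/-- Left multiplication by `c i` on normal forms. -/
noncomputable def cOp (i : Fin 2) : V →ₗ[ZMod 2] V where
  -- The index `i + 1` is taken mod 2: only `c 0 * d 1 = c 1 * d 0` survives.
  toFun w := (FreeAlgebra.ι (ZMod 2) i * w.1, 0,
    algebraMap (ZMod 2) A (w.2.1 (i + 1)) + FreeAlgebra.ι (ZMod 2) i * w.2.2)
  map_add' v w := by
    ext1
    · simp [mul_add]
    · simp only [Prod.fst_add, Prod.snd_add, Pi.add_apply, map_add, mul_add, Prod.mk_add_mk,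
        add_zero, Prod.mk.injEq, true_and]
      abel
  map_smul' r w := by
    simp [Algebra.smul_def r, mul_add, Algebra.left_comm]

/-- Left multiplication by `d i` on normal forms. -/
noncomputable def dOp (i : Fin 2) : V →ₗ[ZMod 2] V where
  toFun w := (0, Pi.single i (aug w.1), 0)
  map_add' v w := by simp [Pi.single_add]
  map_smul' r w := by simp [← Pi.single_smul]

theorem cOp_apply (i : Fin 2) (w : V) : cOp i w = (FreeAlgebra.ι (ZMod 2) i * w.1, 0,
    algebraMap (ZMod 2) A (w.2.1 (i + 1)) + FreeAlgebra.ι (ZMod 2) i * w.2.2) := rfl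

theorem dOp_apply (i : Fin 2) (w : V) : dOp i w = (0, Pi.single i (aug w.1), 0) := rfl

/-- The representation of `S` by left multiplication on normal forms. -/
noncomputable def rep : S →ₐ[ZMod 2] Module.End (ZMod 2) V :=
  liftS (fun | .c i => cOp i | .d i => dOp i) <| lift_relators _
    (LinearMap.ext fun w => by simp [cOp_apply, dOp_apply])
    (LinearMap.ext fun w => by simp [cOp_apply, dOp_apply, add_self_eq_zero])
    (LinearMap.ext fun w => by simp [cOp_apply, dOp_apply])
    (fun i j => LinearMap.ext fun w => by simp [dOp_apply])
    (fun i j => LinearMap.ext fun w => by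
      simp [cOp_apply, dOp_apply, FreeAlgebra.algebraMapInv])

theorem rep_cS (i : Fin 2) : rep (cS i) = cOp i := liftS_cS _ _ i

theorem rep_dS (i : Fin 2) : rep (dS i) = dOp i := liftS_dS _ _ i

/-- The action is triangular; this and the next two lemmas compute it on the graded pieces. -/
theorem rep_fst (s : S) : ∀ w : V, (rep s w).1 = toA s * w.1 := by
  induction s using S_induction with
  | algebraMap r => intro w; simp [Algebra.smul_def]
  | c i => intro w; rw [rep_cS, toA_cS, cOp_apply]
  | d i => intro w; rw [rep_dS, toA_dS, dOp_apply, zero_mul]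
  | mul s t hs ht => intro w; rw [map_mul, Module.End.mul_apply, hs, ht, map_mul, mul_assoc]
  | add s t hs ht => intro w; simp [hs, ht, add_mul]

theorem rep_snd_fst (s : S) (i : Fin 2) :
    ∀ w : V, w.1 = 0 → (rep s w).2.1 i = augS s * w.2.1 i := by
  induction s using S_induction with
  | algebraMap r => intro w _; simp
  | c j => intro w _; simp [rep_cS, cOp_apply, augS_apply, toA_cS, aug_ι]
  | d j => intro w hw; simp [rep_dS, dOp_apply, augS_apply, toA_dS, hw]
  | mul s t hs ht =>
    intro w hw
    rw [map_mul, Module.End.mul_apply, hs _ (by rw [rep_fst, hw, mul_zero]), ht _ hw, map_mul,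
      mul_assoc]
  | add s t hs ht => intro w hw; simp [hs w hw, ht w hw, add_mul]

theorem rep_snd_snd (s : S) :
    ∀ w : V, w.1 = 0 → w.2.1 = 0 → (rep s w).2.2 = toA s * w.2.2 := by
  induction s using S_induction with
  | algebraMap r => intro w _ _; simp [Algebra.smul_def]
  | c j => intro w _ hw; simp [rep_cS, cOp_apply, toA_cS, hw]
  | d j => intro w hw; simp [rep_dS, dOp_apply, toA_dS]
  | mul s t hs ht =>
    intro w hw hw'
    rw [map_mul, Module.End.mul_apply, hs _ (by rw [rep_fst, hw, mul_zero])
      (by ext i; rw [rep_snd_fst _ _ _ hw, hw']; simp), ht _ hw hw', map_mul, mul_assoc]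
  | add s t hs ht => intro w hw hw'; simp [hs w hw hw', ht w hw hw', add_mul]

/-- The element of `S` with a given normal form. -/
noncomputable def ofV (w : V) : S :=
  ofA w.1 + (w.2.1 0 • dS 0 + w.2.1 1 • dS 1) + ofA w.2.2 * (cS 1 * dS 0)

theorem augS_ofA (a : A) : augS (ofA a) = aug a := by
  have : augS.comp ofA = aug := by
    ext i
    simp [augS_apply, ofA_ι, toA_cS]
  exact DFunLike.congr_fun this a

/-- Evaluated at `(1, 0, 0)`, this recovers `s` from its normal form. -/
theorem ofV_rep (s : S) : ∀ w : V, ofV (rep s w) = s * ofV w := by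
  induction s using S_induction with
  | algebraMap r =>
    intro w
    simp only [AlgHom.commutes, Module.algebraMap_end_apply, ofV, Prod.smul_fst, Prod.smul_snd,
      map_smul, Pi.smul_apply, smul_eq_mul, mul_smul, ← Algebra.smul_def, smul_add, smul_mul_assoc]
  | c i =>
    intro w
    have h1 : cS i * (w.2.1 0 • dS 0 + w.2.1 1 • dS 1) = w.2.1 (i + 1) • (cS 1 * dS 0) := by
      fin_cases i
      · simp [mul_add, cS_zero_mul_dS_zero, cS_zero_mul_dS_one]
      · simp [mul_add, cS_one_mul_dS_one]
    rw [rep_cS, cOp_apply, ofV, ofV, mul_add, mul_add, h1]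
    simp [ofA_ι, add_mul, mul_assoc, ← Algebra.smul_def, add_assoc]
  | d i =>
    intro w
    rw [rep_dS, dOp_apply, dS_mul]
    have : augS (ofV w) = aug w.1 := by
      simp [ofV, augS_ofA, augS_apply (dS _), toA_dS]
    rw [this, ofV]
    fin_cases i <;> simp
  | mul s t hs ht => intro w; rw [map_mul, Module.End.mul_apply, hs, ht, mul_assoc]
  | add s t hs ht =>
    intro w
    rw [add_mul, ← hs, ← ht, map_add, LinearMap.add_apply]
    simp only [ofV, Prod.fst_add, Prod.snd_add, Pi.add_apply, map_add, add_smul, add_mul]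
    abel

/-- The normal form of an element of `S`. -/
noncomputable def normalForm : S →+ V where
  toFun s := rep s (1, 0, 0)
  map_zero' := by simp
  map_add' s t := by simp

theorem normalForm_apply (s : S) : normalForm s = rep s (1, 0, 0) := rfl

theorem ofV_normalForm (s : S) : ofV (normalForm s) = s := by
  rw [normalForm_apply, ofV_rep]
  simp [ofV]

theorem normalForm_injective : Function.Injective normalForm :=
  Function.LeftInverse.injective ofV_normalForm

theorem normalForm_mul (s t : S) : normalForm (s * t) = rep s (normalForm t) := by
  simp [normalForm_apply]

theorem normalForm_fst (s : S) : (normalForm s).1 = toA s := by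
  rw [normalForm_apply, rep_fst, mul_one]

/-- Every term of the normal form of `m` ends in some `d i`, so `dS_mul` applies. -/
theorem mul_eq_augS_smul {m : S} (hm : toA m = 0) (s : S) : m * s = augS s • m := by
  rw [← ofV_normalForm m, ofV, normalForm_fst, hm]
  simp only [map_zero, zero_add, add_mul, smul_mul_assoc, mul_assoc, dS_mul, mul_smul_comm,
    smul_add, smul_comm (augS s)]

theorem dS_ne_zero (i : Fin 2) : dS i ≠ 0 := by
  intro h
  have := congrFun (congrArg (fun w : V => w.2.1) (congrArg normalForm h)) i
  simp [normalForm_apply, rep_dS, dOp_apply] at this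

theorem cS_ne_zero (i : Fin 2) : cS i ≠ 0 := by
  intro h
  have := congrArg toA h
  rw [toA_cS, map_zero] at this
  exact FreeAlgebra.ι_ne_zero _ this

/-! ### Cancellation in polynomials over the kernel of `toA` -/

theorem C_dS_mul_eq_zero {g : S[X]} (hg : g.map augS.toRingHom = 0) (i : Fin 2) :
    C (dS i) * g = 0 := by
  ext n
  have : augS (g.coeff n) = 0 := by simpa using congrArg (coeff · n) hg
  rw [coeff_C_mul, dS_mul, this, zero_smul, coeff_zero]

theorem map_augS_eq_zero {g : S[X]} (hg : g.map toA.toRingHom = 0) :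
    g.map augS.toRingHom = 0 := by
  ext n
  have : toA (g.coeff n) = 0 := by simpa using congrArg (coeff · n) hg
  simp [augS_apply, this]

/-- Polynomials over the kernel of `toA` are torsion free over `(ZMod 2)[X]`. -/
theorem eq_zero_or_map_augS_eq_zero {f g : S[X]} (hf : f.map toA.toRingHom = 0)
    (hfg : f * g = 0) : f = 0 ∨ g.map augS.toRingHom = 0 := by
  by_contra! h
  obtain ⟨hf0, hg0⟩ := h
  -- Over `ZMod 2` a nonzero polynomial is monic, hence cancellable over any ring.
  have hmonic : (g.map augS.toRingHom).Monic := by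
    have : ∀ x : ZMod 2, x ≠ 0 → x = 1 := by decide
    exact this _ (leadingCoeff_ne_zero.2 hg0)
  have hmul : f * (g.map augS.toRingHom).map (algebraMap (ZMod 2) S) = f * g := by
    ext n
    simp only [coeff_mul, coeff_map]
    refine Finset.sum_congr rfl fun p _ => ?_
    have : toA (f.coeff p.1) = 0 := by simpa using congrArg (coeff · p.1) hf
    rw [mul_eq_augS_smul this (g.coeff p.2), Algebra.smul_def, Algebra.commutes]
    rfl
  rw [hfg] at hmul
  exact hf0 (((hmonic.map _).mul_left_eq_zero_iff).1 hmul)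

/-- The coefficient of `d i` in the normal form. -/
noncomputable def dCoeff (i : Fin 2) : S →+ ZMod 2 :=
  (Pi.evalAddMonoidHom _ i).comp <| (AddMonoidHom.fst _ _).comp <|
    (AddMonoidHom.snd _ _).comp normalForm

/-- The left coefficient of `c 1 * d 0` in the normal form. -/
noncomputable def cdCoeff : S →+ A :=
  (AddMonoidHom.snd _ _).comp <| (AddMonoidHom.snd _ _).comp normalForm

theorem dCoeff_apply (i : Fin 2) (s : S) : dCoeff i s = (normalForm s).2.1 i := rfl

theorem cdCoeff_apply (s : S) : cdCoeff s = (normalForm s).2.2 := rfl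

theorem eq_zero_of_coeffs {s : S} (h : toA s = 0) (hd : ∀ i, dCoeff i s = 0)
    (hcd : cdCoeff s = 0) : s = 0 := by
  apply normalForm_injective
  rw [map_zero]
  exact Prod.ext ((normalForm_fst s).trans h) (Prod.ext (funext hd) hcd)

theorem dCoeff_mul (i : Fin 2) (s : S) {m : S} (hm : toA m = 0) :
    dCoeff i (s * m) = augS s * dCoeff i m := by
  rw [dCoeff_apply, normalForm_mul, rep_snd_fst _ _ _ (by rw [normalForm_fst, hm])]
  rfl

theorem cdCoeff_mul (s : S) {m : S} (hm : toA m = 0) (hd : ∀ i, dCoeff i m = 0) :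
    cdCoeff (s * m) = toA s * cdCoeff m := by
  rw [cdCoeff_apply, normalForm_mul, rep_snd_snd _ _ (by rw [normalForm_fst, hm]) (funext hd)]
  rfl

/-- The `d`-coefficients of `g` vanish by cancelling in `(ZMod 2)[X]`; only then is `cdCoeff`
multiplicative, and one cancels in `A[X]`. -/
theorem eq_zero_of_mul_eq_zero {f g : S[X]} (hf : f.map augS.toRingHom ≠ 0)
    (hg : g.map toA.toRingHom = 0) (hfg : f * g = 0) : g = 0 := by
  have hA (n : ℕ) : toA (g.coeff n) = 0 := by simpa using congrArg (coeff · n) hg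
  have hd (i : Fin 2) : ∀ n, dCoeff i (g.coeff n) = 0 := by
    rw [← coeffMap_eq_zero_iff]
    have := coeffMap_mul_eq_map_mul augS.toRingHom (dCoeff i) f g
      fun j k => dCoeff_mul i _ (hA k)
    rw [hfg, (coeffMap_eq_zero_iff _ _).2 (by simp)] at this
    exact (mul_eq_zero.1 this.symm).resolve_left hf
  have hcd : ∀ n, cdCoeff (g.coeff n) = 0 := by
    rw [← coeffMap_eq_zero_iff]
    have := coeffMap_mul_eq_map_mul toA.toRingHom cdCoeff f g
      fun j k => cdCoeff_mul _ (hA k) fun i => hd i k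
    rw [hfg, (coeffMap_eq_zero_iff _ _).2 (by simp)] at this
    exact (mul_eq_zero.1 this.symm).resolve_left fun h => hf (map_augS_eq_zero h)
  ext n
  exact eq_zero_of_coeffs (hA n) (fun i => hd i n) (hcd n)

/-! ### The McCoy conditions -/

theorem isLeftMcCoy : IsLeftMcCoy S := by
  intro f g hf _ hfg
  refine ⟨dS 0, dS_ne_zero 0, C_dS_mul_eq_zero ?_ 0⟩
  have h := congrArg (Polynomial.map toA.toRingHom) hfg
  rw [Polynomial.map_mul, Polynomial.map_zero, mul_eq_zero] at h
  rcases h with h | h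
  · exact (eq_zero_or_map_augS_eq_zero h hfg).resolve_left hf
  · exact map_augS_eq_zero h

theorem isInnerMcCoy : IsInnerMcCoy S := by
  intro f g hf hg hfgf
  refine ⟨dS 0, dS_ne_zero 0, ?_⟩
  suffices h : f.map augS.toRingHom = 0 by rw [mul_assoc, C_dS_mul_eq_zero h, mul_zero]
  by_contra hne
  have h := congrArg (Polynomial.map toA.toRingHom) hfgf
  simp only [Polynomial.map_mul, Polynomial.map_zero, mul_eq_zero] at h
  have hfA : f.map toA.toRingHom ≠ 0 := fun h => hne (map_augS_eq_zero h)
  have hgA : g.map toA.toRingHom = 0 := by tauto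
  have hfg : f * g = 0 :=
    (eq_zero_or_map_augS_eq_zero (by rw [Polynomial.map_mul, hgA, mul_zero]) hfgf).resolve_right hne
  exact hg (eq_zero_of_mul_eq_zero hne hgA hfg)

theorem F_mul_G : F * G = 0 := by
  change (C (cS 0) + C (cS 1) * X) * (C (dS 0) + C (dS 1) * X) = 0
  have : (C (cS 0) + C (cS 1) * X) * (C (dS 0) + C (dS 1) * X) =
      C (cS 0 * dS 0) + C (cS 0 * dS 1 + cS 1 * dS 0) * X + C (cS 1 * dS 1) * X ^ 2 := by
    simp only [C_mul, C_add, add_mul, mul_add, mul_assoc, X_mul, pow_two]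
    abel
  rw [this, cS_zero_mul_dS_zero, cS_mul_dS_add, cS_one_mul_dS_one]
  simp

theorem F_ne_zero : F ≠ 0 := by
  intro h
  apply cS_ne_zero 0
  simpa [F, cS] using congrArg (coeff · 0) h

theorem G_ne_zero : G ≠ 0 := by
  intro h
  apply dS_ne_zero 0
  simpa [G, dS] using congrArg (coeff · 0) h

/-- No nonzero element is annihilated by both `c 0` and `c 1` from the left. -/
theorem eq_zero_of_cS_mul_eq_zero {r : S} (h : ∀ i, cS i * r = 0) : r = 0 := by
  have hV (i : Fin 2) : cOp i (normalForm r) = 0 := by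
    rw [← rep_cS, ← normalForm_mul, h, map_zero]
  have hι (i : Fin 2) : FreeAlgebra.ι (ZMod 2) i ≠ 0 := FreeAlgebra.ι_ne_zero _
  have hlast (i : Fin 2) : algebraMap (ZMod 2) A (dCoeff (i + 1) r) +
      FreeAlgebra.ι (ZMod 2) i * cdCoeff r = 0 := congrArg (fun w : V => w.2.2) (hV i)
  -- The augmentation kills the multiple of the generator and isolates the scalar.
  have hd (i : Fin 2) : dCoeff (i + 1) r = 0 := by
    simpa [FreeAlgebra.algebraMapInv] using congrArg aug (hlast i)
  refine eq_zero_of_coeffs ?_ (fun i => ?_) ?_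
  · have := congrArg (fun w : V => w.1) (hV 0)
    rw [← normalForm_fst]
    exact (mul_eq_zero.1 this).resolve_left (hι 0)
  · fin_cases i
    · exact hd 1
    · exact hd 0
  · have := hlast 0
    rw [hd, map_zero, zero_add] at this
    exact (mul_eq_zero.1 this).resolve_left (hι 0)

theorem F_mul_C_ne_zero {r : S} (hr : r ≠ 0) : F * C r ≠ 0 := by
  intro h
  refine hr (eq_zero_of_cS_mul_eq_zero fun i => ?_)
  fin_cases i
  · simpa [F, cS] using congrArg (coeff · 0) h
  · simpa [F, cS, coeff_C] using congrArg (coeff · 1) h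

theorem not_isRightMcCoy : ¬ IsRightMcCoy S := by
  intro h
  obtain ⟨s, hs, hFs⟩ := h F G F_ne_zero G_ne_zero F_mul_G
  exact F_mul_C_ne_zero hs hFs

end Nielsen

theorem mainTheorem9 :
    IsInnerMcCoy Nielsen.S ∧
    IsLeftMcCoy Nielsen.S ∧
    (Nielsen.F ≠ 0 ∧ Nielsen.G ≠ 0 ∧ Nielsen.F * Nielsen.G = 0 ∧
      ∀ r : Nielsen.S, r ≠ 0 → Nielsen.F * Polynomial.C r ≠ 0) ∧
    ¬ IsRightMcCoy Nielsen.S ∧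
    ¬ IsMcCoy Nielsen.S :=
  ⟨Nielsen.isInnerMcCoy, Nielsen.isLeftMcCoy,
    ⟨Nielsen.F_ne_zero, Nielsen.G_ne_zero, Nielsen.F_mul_G, fun _ => Nielsen.F_mul_C_ne_zero⟩,
    Nielsen.not_isRightMcCoy, fun h => Nielsen.not_isRightMcCoy h.2⟩
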